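/- For a finite simple graph $G$ and an integer $g\ge 0$, a set $S\subseteq V(G)$ is a $g$-extra cut if $G-S$ is disconnected and every connected component of $G-S$ has at least $g+1$ vertices. The $g$-extra connectivity $\kappa_g(G)$ is the minimum cardinality of a $g$-extra cut of $G$, and $\kappa_g(G)=\infty$ if $G$ has no $g$-extra cut. The strong product $G_1\boxtimes G_2$ has vertex set $V(G_1)\times V(G_2)$, and two distinct vertices $(x_1,y_1)$, $(x_2,y_2)$ are adjacent if and only if ($x_1=x_2$ or $x_1x_2\in E(G_1)$) and ($y_1=y_2$ or $y_1y_2\in E(G_2)$). Let $C_m$ be the cycle with $m$ vertices and $P_n$ the path with $n$ vertices. **Theorem.** Let $m\ge 4$, $n\ge 3$ and $g\ge 0$ be integers, and let $G=C_m\boxtimes P_n$. If $$g\le\min\left\{n\left\lfloor\frac{m-2}{2}\right\rfloor-1,\ m\left\lfloor\frac{n-1}{2}\right\rfloor-1\right\},$$ then $$\kappa_g(G)=\min\left\{m,\ 2n,\ \left\lceil 2\sqrt{2(g+1)}\,\right\rceil+2\right\}.$$ -/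

import Mathlib

/-- The strong product of two simple graphs: distinct pairs are adjacent iff in each coordinate
their entries are equal or adjacent. -/
def SimpleGraph.strongProd {V W : Type*} (G : SimpleGraph V) (H : SimpleGraph W) :
    SimpleGraph (V × W) where
  Adj p q := (p.1 = q.1 ∧ H.Adj p.2 q.2) ∨ (p.2 = q.2 ∧ G.Adj p.1 q.1) ∨
    (G.Adj p.1 q.1 ∧ H.Adj p.2 q.2)
  symm := ⟨by
    rintro p q (⟨h₁, h₂⟩ | ⟨h₁, h₂⟩ | ⟨h₁, h₂⟩)
    · exact Or.inl ⟨h₁.symm, h₂.symm⟩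
    · exact Or.inr (Or.inl ⟨h₁.symm, h₂.symm⟩)
    · exact Or.inr (Or.inr ⟨h₁.symm, h₂.symm⟩)⟩
  loopless := ⟨by
    rintro p (⟨_, h⟩ | ⟨_, h⟩ | ⟨h, _⟩)
    · exact H.irrefl h
    · exact G.irrefl h
    · exact G.irrefl h⟩

/-- A set `S` of vertices is a `g`-extra cut of `G` if `G - S` is disconnected (it has two vertices
that are not joined by a walk) and each connected component of `G - S` has at least `g + 1`
vertices. -/
def SimpleGraph.IsExtraCut {V : Type*} (G : SimpleGraph V) (g : ℕ) (S : Set V) : Prop :=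
  ¬ (G.induce Sᶜ).Preconnected ∧
    ∀ c : (G.induce Sᶜ).ConnectedComponent, ((g + 1 : ℕ) : ℕ∞) ≤ c.supp.encard

/-- The `g`-extra connectivity of `G`: the minimum order of a `g`-extra cut of `G`, and `⊤` if
there is none. -/
noncomputable def SimpleGraph.extraConnectivity {V : Type*} (G : SimpleGraph V) (g : ℕ) : ℕ∞ :=
  ⨅ (S : Set V) (_ : G.IsExtraCut g S), S.encard

/-! Upper bound: cut off `k` full rows (boundary `m`), `k` full columns (boundary `2 * n`), or an `a
× b` rectangle resting on an end row of the path (boundary `a + 2 * b + 2`). The bound on `g` makes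
the first two cuts valid. Lower bound: a cut smaller than `m` and `2 * n` misses some column and
meets some row at most once. A component avoiding that column also avoids that row, so it unrolls
into the square lattice with a free row on one side. If it has `a` columns and `b` rows, shifting
left, right and towards that row produces `a + 2 * b + 2` new points, all lifts of distinct cut
vertices (`exists_lattice_expansion`). Both bounds thus minimise `a + 2 * b` subject to `g + 1 ≤ a *
b`. Since `8ab ≤ (a + 2b)²`, the minimum is the least `s` with `8(g + 1) ≤ s²`. -/

/-! ### Expansion in the square lattice -/

open Finset in
/-- If `σ` raises the height `h` by one and preserves the fibres of `π`, then each fibre of `π`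
that meets `D` gains a point when passing from `D` to `D ∪ σ D`. -/
theorem Finset.card_add_card_image_le_card_union_image {α β : Type*} [DecidableEq α]
    [DecidableEq β] (D : Finset α) (σ : α → α) (h : α → ℤ) (π : α → β)
    (hh : ∀ p, h (σ p) = h p + 1) (hπ : ∀ p, π (σ p) = π p) :
    #D + #(D.image π) ≤ #(D ∪ D.image σ) := by
  -- The highest point of `D` in a fibre is sent by `σ` out of `D`.
  have hsub : D.image π ⊆ ((D ∪ D.image σ) \ D).image π := by
    intro r hr
    obtain ⟨p, hp, rfl⟩ := mem_image.1 hr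
    obtain ⟨q, hq, hmax⟩ := exists_max_image (D.filter fun q => π q = π p) h ⟨p, by simp [hp]⟩
    rw [mem_filter] at hq
    refine mem_image.2 ⟨σ q, ?_, by rw [hπ, hq.2]⟩
    refine mem_sdiff.2 ⟨mem_union_right _ (mem_image_of_mem _ hq.1), fun hσ => ?_⟩
    have := hmax (σ q) (mem_filter.2 ⟨hσ, by rw [hπ, hq.2]⟩)
    rw [hh] at this
    omega
  have h1 := (card_le_card hsub).trans card_image_le
  have h2 := card_sdiff_add_card_eq_card (subset_union_left : D ⊆ D ∪ D.image σ)
  omega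

open Finset in
/-- A nonempty finite set in the square lattice with `a` columns and `b` rows has at least
`a + 2 * b + 2` neighbours among its translates by `(±1, 0)`, `(0, ε)` and `(±1, ε)`. -/
theorem exists_lattice_expansion (D : Finset (ℤ × ℤ)) (hD : D.Nonempty) (ε : ℤ)
    (hε : ε = 1 ∨ ε = -1) :
    ∃ (E : Finset (ℤ × ℤ)) (a b : ℕ), #D ≤ a * b ∧ D ⊆ E ∧ #D + a + 2 * b + 2 ≤ #E ∧
      ∀ q ∈ E, ∃ p ∈ D, (q.1 = p.1 - 1 ∨ q.1 = p.1 ∨ q.1 = p.1 + 1) ∧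
        (q.2 = p.2 ∨ q.2 = p.2 + ε) := by
  have h1 := card_add_card_image_le_card_union_image D
    (fun p => (p.1 + 1, p.2)) Prod.fst Prod.snd (fun _ => rfl) (fun _ => rfl)
  set E₁ := D ∪ D.image fun p : ℤ × ℤ => (p.1 + 1, p.2) with hE₁
  have h2 := card_add_card_image_le_card_union_image E₁
    (fun p => (p.1 - 1, p.2)) (fun p => -p.1) Prod.snd (fun p => by dsimp only; ring) (fun _ => rfl)
  set E₂ := E₁ ∪ E₁.image fun p : ℤ × ℤ => (p.1 - 1, p.2) with hE₂
  have h3 := card_add_card_image_le_card_union_image E₂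
    (fun p => (p.1, p.2 + ε)) (fun p => ε * p.2) Prod.fst
    (fun p => by rcases hε with rfl | rfl <;> dsimp only <;> ring) (fun _ => rfl)
  set E₃ := E₂ ∪ E₂.image fun p : ℤ × ℤ => (p.1, p.2 + ε) with hE₃
  -- The same lemma on the projection, with a single fibre: each horizontal shift adds a column. The
  -- vertical shift therefore gains `a + 2`, the horizontal ones at least `b` each.
  have c1 : #(D.image Prod.fst) + 1 ≤ #(E₁.image Prod.fst) := by
    have := card_add_card_image_le_card_union_image (D.image Prod.fst) (fun i : ℤ => i + 1) id
      (fun _ => ()) (fun _ => rfl) (fun _ => rfl)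
    have e : D.image Prod.fst ∪ (D.image Prod.fst).image (fun i : ℤ => i + 1)
        = E₁.image Prod.fst := by
      rw [hE₁, image_union, image_image, image_image]; rfl
    rw [e, image_const (hD.image _), card_singleton] at this
    exact this
  have c2 : #(E₁.image Prod.fst) + 1 ≤ #(E₂.image Prod.fst) := by
    have := card_add_card_image_le_card_union_image (E₁.image Prod.fst) (fun i : ℤ => i - 1)
      (fun i => -i) (fun _ => ()) (fun _ => by ring) (fun _ => rfl)
    have e (F : Finset (ℤ × ℤ)) : F.image Prod.fst ∪ (F.image Prod.fst).image (fun i : ℤ => i - 1)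
        = (F ∪ F.image fun p : ℤ × ℤ => (p.1 - 1, p.2)).image Prod.fst := by
      rw [image_union, image_image, image_image]; rfl
    rw [e, ← hE₂, image_const ((hD.mono subset_union_left).image _), card_singleton] at this
    exact this
  have c3 : #(D.image Prod.snd) ≤ #(E₁.image Prod.snd) :=
    card_le_card (image_subset_image subset_union_left)
  refine ⟨E₃, #(D.image Prod.fst), #(D.image Prod.snd), ?_,
    (subset_union_left.trans subset_union_left).trans subset_union_left, by omega, ?_⟩
  · rw [← card_product]
    refine card_le_card fun p hp => mem_product.2 ⟨mem_image_of_mem _ hp, mem_image_of_mem _ hp⟩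
  · have m1 : ∀ q ∈ E₁, ∃ p ∈ D, (q.1 = p.1 ∨ q.1 = p.1 + 1) ∧ q.2 = p.2 := by
      intro q hq
      rcases mem_union.1 hq with hq | hq
      · exact ⟨q, hq, by simp⟩
      · obtain ⟨p, hp, rfl⟩ := mem_image.1 hq
        exact ⟨p, hp, by simp⟩
    have m2 : ∀ q ∈ E₂, ∃ p ∈ D, (q.1 = p.1 - 1 ∨ q.1 = p.1 ∨ q.1 = p.1 + 1) ∧ q.2 = p.2 := by
      intro q hq
      rcases mem_union.1 hq with hq | hq
      · obtain ⟨p, hp, h, h'⟩ := m1 q hq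
        exact ⟨p, hp, by tauto⟩
      · obtain ⟨r, hr, rfl⟩ := mem_image.1 hq
        obtain ⟨p, hp, h, h'⟩ := m1 r hr
        exact ⟨p, hp, by dsimp only; omega⟩
    intro q hq
    rcases mem_union.1 hq with hq | hq
    · obtain ⟨p, hp, h, h'⟩ := m2 q hq
      exact ⟨p, hp, by tauto⟩
    · obtain ⟨r, hr, rfl⟩ := mem_image.1 hq
      obtain ⟨p, hp, h, h'⟩ := m2 r hr
      exact ⟨p, hp, by dsimp only; omega⟩

/-! ### Lower bound: small cuts -/

/-- The universal cover of the cycle, based at `x`. -/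
theorem SimpleGraph.exists_cycleGraph_cover {m : ℕ} (hm : 2 ≤ m) (x : Fin m) :
    ∃ φ : ℤ → Fin m, φ 0 = x ∧ (∀ i, (cycleGraph m).Adj (φ i) (φ (i + 1))) ∧
      (∀ i j, φ i = φ j ↔ (m : ℤ) ∣ i - j) ∧ ∀ u, ∃ i : ℤ, 0 ≤ i ∧ i < m ∧ φ i = u := by
  obtain ⟨k, rfl⟩ := Nat.exists_eq_add_of_le' hm
  let X : ZMod (k + 2) := x
  let φ : ℤ → ZMod (k + 2) := fun i => X + i
  refine ⟨φ, ?_, fun i => ?_, fun i j => ?_, fun u => ?_⟩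
  · change X + ((0 : ℤ) : ZMod (k + 2)) = X
    simp
  · refine cycleGraph_adj.2 (Or.inr ?_)
    change X + ((i + 1 : ℤ) : ZMod (k + 2)) - (X + (i : ZMod (k + 2))) = 1
    push_cast; ring
  · change X + (i : ZMod (k + 2)) = X + (j : ZMod (k + 2)) ↔ _
    rw [add_right_inj, eq_comm, ZMod.intCast_eq_intCast_iff_dvd_sub]
  · let U : ZMod (k + 2) := u
    refine ⟨((U - X).val : ℤ), by positivity, by exact_mod_cast ZMod.val_lt (U - X), ?_⟩
    change X + (((U - X).val : ℤ) : ZMod (k + 2)) = U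
    rw [Int.cast_natCast, ZMod.natCast_zmod_val]
    ring

/-- If `S` is a `g`-extra cut and `p₀ ∉ S`, then some component `D` of `G - S` misses `p₀`. -/
theorem SimpleGraph.IsExtraCut.exists_component {V : Type*} [Fintype V] {G : SimpleGraph V}
    {g : ℕ} {S : Set V} (hS : G.IsExtraCut g S) {p₀ : V} (hp₀ : p₀ ∉ S) :
    ∃ D : Finset V, g + 1 ≤ D.card ∧ (∀ p ∈ D, p ∉ S) ∧
      (∀ p ∈ D, ∀ q, q ∉ S → G.Adj p q → q ∈ D) ∧ p₀ ∉ D ∧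
      ∀ P : V → Prop, (∃ p ∈ D, P p) → (∀ p ∈ D, ∀ q ∈ D, G.Adj p q → P p → P q) →
        ∀ q ∈ D, P q := by
  classical
  obtain ⟨hdis, hcard⟩ := hS
  have : ∃ c : (G.induce Sᶜ).ConnectedComponent,
      c ≠ (G.induce Sᶜ).connectedComponentMk ⟨p₀, hp₀⟩ := by
    by_contra! hc
    exact hdis fun u v => ConnectedComponent.exact ((hc _).trans (hc _).symm)
  obtain ⟨c, hc⟩ := this
  have hmem : ∀ p, p ∈ (Subtype.val '' c.supp).toFinset ↔
      ∃ h : p ∉ S, (G.induce Sᶜ).connectedComponentMk ⟨p, h⟩ = c := by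
    intro p
    simp [ConnectedComponent.mem_supp_iff]
  refine ⟨(Subtype.val '' c.supp).toFinset, ?_, ?_, ?_, ?_, ?_⟩
  · have := hcard c
    rw [← Subtype.val_injective.encard_image, Set.encard_eq_coe_toFinset_card] at this
    exact_mod_cast this
  · intro p hp
    exact ((hmem p).1 hp).1
  · intro p hp q hq hpq
    obtain ⟨h, rfl⟩ := (hmem p).1 hp
    refine (hmem q).2 ⟨hq, ConnectedComponent.sound (Adj.reachable ?_)⟩
    exact hpq.symm
  · intro hp
    obtain ⟨h, e⟩ := (hmem p₀).1 hp
    exact hc e.symm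
  · rintro P ⟨p, hp, hPp⟩ hP q hq
    obtain ⟨h, rfl⟩ := (hmem p).1 hp
    obtain ⟨h', e⟩ := (hmem q).1 hq
    have hr := ConnectedComponent.exact e.symm
    rw [reachable_iff_reflTransGen] at hr
    have key : ∀ r, Relation.ReflTransGen (G.induce Sᶜ).Adj ⟨p, h⟩ r → P r := by
      intro r hr
      induction hr with
      | refl => exact hPp
      | tail hab hbc ih =>
        rename_i b c
        have hb := ((reachable_iff_reflTransGen _ _).2 hab)
        refine hP b ((hmem _).2 ⟨b.2, ConnectedComponent.sound hb.symm⟩) c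
          ((hmem _).2 ⟨c.2, ConnectedComponent.sound (hb.trans hbc.reachable).symm⟩) hbc ih
    exact key _ hr

open Finset in
/-- A `g`-extra cut of `C_m ⊠ P_n` with fewer than `min m (2 * n)` vertices isolates a set of at
least `g + 1` vertices with `a` columns and `b` rows, and so has at least `a + 2 * b + 2`
vertices. -/
theorem SimpleGraph.IsExtraCut.exists_le_card {m n g : ℕ} (hm : 2 ≤ m)
    {S : Finset (Fin m × Fin n)}
    (hS : ((cycleGraph m).strongProd (pathGraph n)).IsExtraCut g S)
    (h₁ : #S < m) (h₂ : #S < 2 * n) :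
    ∃ a b : ℕ, g + 1 ≤ a * b ∧ a + 2 * b + 2 ≤ #S := by
  classical
  obtain ⟨x, hx⟩ : ∃ x, ∀ j, (x, j) ∉ S := by
    by_contra! h
    have : (univ : Finset (Fin m)) ⊆ S.image Prod.fst := fun x _ =>
      let ⟨j, hj⟩ := h x
      mem_image.2 ⟨_, hj, rfl⟩
    have := (card_le_card this).trans card_image_le
    rw [card_univ, Fintype.card_fin] at this
    omega
  obtain ⟨y, hy⟩ : ∃ y, ∀ u v, (u, y) ∈ S → (v, y) ∈ S → u = v := by
    obtain ⟨y, -, hy⟩ := exists_card_fiber_lt_of_card_lt_mul (s := S)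
      (t := (univ : Finset (Fin n))) (f := Prod.snd) (n := 2)
      (by rw [card_univ, Fintype.card_fin]; omega)
    refine ⟨y, fun u v hu hv => ?_⟩
    have := card_le_one.1 (Nat.le_of_lt_succ hy) (u, y) (by simp [hu]) (v, y) (by simp [hv])
    exact congrArg Prod.fst this
  obtain ⟨φ, φ0, φadj, φeq, φsurj⟩ := exists_cycleGraph_cover hm x
  obtain ⟨D, hcard, hDS, hclosed, hp₀, hconn⟩ :=
    hS.exists_component (p₀ := (x, y)) (by simpa using hx y)
  simp only [mem_coe] at hDS hclosed
  set G := (cycleGraph m).strongProd (pathGraph n) with hG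
  have hrowadj : ∀ i j, G.Adj (φ i, j) (φ (i + 1), j) := fun i j =>
    Or.inr (Or.inl ⟨rfl, φadj i⟩)
  have hcol : ∀ j, (x, j) ∉ D := by
    have hup : ∀ k : ℕ, ∀ j : Fin n, (j.val = y.val + k ∨ y.val = j.val + k) → (x, j) ∉ D := by
      intro k
      induction k with
      | zero =>
        intro j hj
        have : j = y := Fin.ext (by omega)
        rwa [this]
      | succ k ih =>
        rintro j (hj | hj) hD
        · have hlt : y.val + k < n := by omega
          refine ih ⟨y.val + k, hlt⟩ (Or.inl rfl) (hclosed _ hD _ (hx _) (Or.inl ⟨rfl, ?_⟩))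
          exact pathGraph_adj.2 (Or.inr (by dsimp only; omega))
        · have hlt : j.val + 1 < n := by omega
          refine ih ⟨j.val + 1, hlt⟩ (Or.inr (by dsimp only; omega))
            (hclosed _ hD _ (hx _) (Or.inl ⟨rfl, ?_⟩))
          exact pathGraph_adj.2 (Or.inl rfl)
    intro j
    rcases le_total y.val j.val with h | h
    · exact hup (j.val - y.val) j (by omega)
    · exact hup (y.val - j.val) j (by omega)
  have hfwd : ∀ k : ℕ, (∀ i : ℤ, 0 ≤ i → i ≤ k → (φ i, y) ∉ S) → (φ k, y) ∉ D := by
    intro k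
    induction k with
    | zero => intro _; rw [Nat.cast_zero, φ0]; exact hcol y
    | succ k ih =>
      intro hk hD
      refine ih (fun i h0 h1 => hk i h0 (by push_cast; omega)) ?_
      refine hclosed _ hD _ (hk _ (by omega) (by push_cast; omega)) ?_
      have := (hrowadj k y).symm
      exact_mod_cast this
  have hbwd : ∀ k : ℕ, (∀ i : ℤ, 0 ≤ i → i ≤ k → (φ (-i), y) ∉ S) → (φ (-k), y) ∉ D := by
    intro k
    induction k with
    | zero => intro _; rw [Nat.cast_zero, neg_zero, φ0]; exact hcol y
    | succ k ih =>
      intro hk hD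
      refine ih (fun i h0 h1 => hk i h0 (by push_cast; omega)) ?_
      refine hclosed _ hD _ (hk _ (by omega) (by push_cast; omega)) ?_
      have := hrowadj (-((k + 1 : ℕ) : ℤ)) y
      rwa [show -((k + 1 : ℕ) : ℤ) + 1 = -k by push_cast; ring] at this
  -- Both arcs of row `y` from column `x` to a vertex of `D` must meet `S`. Row `y` has at most one
  -- vertex of `S`, so the arcs meet `S` only at their common end, which lies in `D`.
  have hrow : ∀ u, (u, y) ∉ D := by
    intro u hu
    obtain ⟨k, hk0, hkm, rfl⟩ := φsurj u
    obtain ⟨i, hi0, hik, hi⟩ : ∃ i : ℤ, 0 ≤ i ∧ i ≤ k ∧ (φ i, y) ∈ S := by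
      by_contra! h
      refine hfwd k.toNat (fun i h0 h1 => h i h0 (by omega)) ?_
      rwa [Int.toNat_of_nonneg hk0]
    obtain ⟨j, hj0, hjk, hj⟩ : ∃ j : ℤ, 0 ≤ j ∧ j ≤ m - k ∧ (φ (-j), y) ∈ S := by
      by_contra! h
      refine hbwd (m - k).toNat (fun i h0 h1 => h i h0 (by omega)) ?_
      rw [Int.toNat_of_nonneg (by omega)]
      rwa [(φeq (-(m - k)) k).2 ⟨-1, by ring⟩]
    have hne : i ≠ 0 := by
      rintro rfl
      rw [φ0] at hi
      exact hx _ hi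
    have hdvd := (φeq _ _).1 (hy _ _ hi hj)
    have hle := Int.le_of_dvd (by omega) hdvd
    have : i = k := by omega
    subst this
    exact hDS _ hu hi
  -- `D` lies strictly on one side of the row `y`.
  have hside : ∃ ε : ℤ, (ε = 1 ∨ ε = -1) ∧
      ∀ p ∈ D, 0 ≤ (p.2.val : ℤ) + ε ∧ (p.2.val : ℤ) + ε < n := by
    have hstep : ∀ p ∈ D, ∀ q ∈ D, G.Adj p q →
        p.2.val ≠ y.val ∧ q.2.val ≠ y.val ∧ q.2.val ≤ p.2.val + 1 ∧ p.2.val ≤ q.2.val + 1 := by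
      intro p hp q hq hpq
      refine ⟨fun h => hrow p.1 ?_, fun h => hrow q.1 ?_, ?_⟩
      · rwa [← Fin.ext h]
      · rwa [← Fin.ext h]
      · rcases hpq with ⟨_, h⟩ | ⟨h, _⟩ | ⟨_, h⟩
        · rw [pathGraph_adj] at h; omega
        · rw [h]; omega
        · rw [pathGraph_adj] at h; omega
    have hyn := y.isLt
    -- `ε` points towards row `y`, so the vertical shift never leaves the path.
    by_cases h : ∃ p ∈ D, p.2.val < y.val
    · have := hconn (fun p => p.2.val < y.val) h (fun p hp q hq hpq hlt => by
        have := hstep p hp q hq hpq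
        omega)
      exact ⟨1, Or.inl rfl, fun p hp => by have := this p hp; omega⟩
    · push Not at h
      refine ⟨-1, Or.inr rfl, fun p hp => ?_⟩
      have h1 := h p hp
      have h2 : p.2.val ≠ y.val := fun h => hrow p.1 (by rwa [← Fin.ext h])
      have := p.2.isLt
      omega
  obtain ⟨ε, hε, hside⟩ := hside
  -- Lift `D` to the square lattice along the universal cover of the cycle.
  let ι : Fin m × Fin n → ℤ × ℤ := fun p => ((φsurj p.1).choose, (p.2.val : ℤ))
  have hι : ∀ p, 0 ≤ (ι p).1 ∧ (ι p).1 < m ∧ φ (ι p).1 = p.1 := fun p => (φsurj p.1).choose_spec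
  have hιinj : Function.Injective ι := by
    intro p q h
    refine Prod.ext ?_ (Fin.ext (Int.ofNat_inj.1 (congrArg Prod.snd h)))
    rw [← (hι p).2.2, ← (hι q).2.2, h]
  have hι0 : ∀ p ∈ D, 0 < (ι p).1 := by
    intro p hp
    refine lt_of_le_of_ne (hι p).1 fun h => hcol p.2 ?_
    have := (hι p).2.2
    rw [← h, φ0] at this
    rwa [this]
  obtain ⟨E, a, b, hab, hDE, hE, hEmem⟩ := exists_lattice_expansion (D.image ι)
    ((card_pos.1 (by omega)).image _) ε hε
  rw [card_image_of_injective _ hιinj] at hab hE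
  refine ⟨a, b, by omega, ?_⟩
  have hnbr : ∀ q ∈ E, ∃ j : Fin n, (j.val : ℤ) = q.2 ∧ 0 < q.1 ∧ q.1 < m ∧
      ((φ q.1, j) ∈ D ∨ (φ q.1, j) ∈ S) := by
    intro q hq
    obtain ⟨p', hp', hq1, hq2⟩ := hEmem q hq
    obtain ⟨p, hp, rfl⟩ := mem_image.1 hp'
    have hs := hside p hp
    have hp2 := p.2.isLt
    have hιp2 : (ι p).2 = (p.2.val : ℤ) := rfl
    obtain ⟨j, hj⟩ : ∃ j : Fin n, (j.val : ℤ) = q.2 :=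
      ⟨⟨q.2.toNat, by omega⟩, by dsimp only; omega⟩
    have hadj1 : φ q.1 = p.1 ∨ (cycleGraph m).Adj p.1 (φ q.1) := by
      rw [← (hι p).2.2]
      rcases hq1 with h | h | h
      · right
        have := (φadj q.1).symm
        rwa [show q.1 + 1 = (ι p).1 by omega] at this
      · left; rw [h]
      · right; rw [h]; exact φadj _
    have hadj2 : j = p.2 ∨ (pathGraph n).Adj p.2 j := by
      rw [pathGraph_adj, Fin.ext_iff]
      omega
    have hor : (φ q.1, j) ∈ D ∨ (φ q.1, j) ∈ S := by
      by_cases hqS : (φ q.1, j) ∈ S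
      · exact Or.inr hqS
      left
      rcases hadj1 with h1 | h1 <;> rcases hadj2 with h2 | h2
      · rwa [h1, h2]
      · exact hclosed p hp _ hqS (Or.inl ⟨h1.symm, h2⟩)
      · exact hclosed p hp _ hqS (Or.inr (Or.inl ⟨h2.symm, h1⟩))
      · exact hclosed p hp _ hqS (Or.inr (Or.inr ⟨h1, h2⟩))
    -- Column `x` avoids both `D` and `S`, so the shifted points stay strictly between `0` and `m`,
    -- where `φ` is injective.
    have hnx : φ q.1 ≠ x := by
      intro h
      rw [h] at hor
      exact hor.elim (hcol j) (hx j)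
    have h0 : q.1 ≠ 0 := fun h => hnx (by rw [h, φ0])
    have hm' : q.1 ≠ m := fun h => hnx (by rw [← φ0, φeq, h, sub_zero])
    have := hι0 p hp
    have := (hι p).2.1
    exact ⟨j, hj, by omega, by omega, hor⟩
  have hle : #(E \ D.image ι) ≤ #S := by
    refine card_le_card_of_surjOn ι ?_
    intro q hq
    rw [mem_coe, mem_sdiff] at hq
    obtain ⟨j, hj, h0, hlt, hor⟩ := hnbr q hq.1
    have hιq : ι (φ q.1, j) = q := by
      have h := hι (φ q.1, j)
      have hd := (φeq _ _).1 h.2.2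
      refine Prod.ext ?_ hj
      have h1 := h.1
      have h2 := h.2.1
      have := Int.eq_zero_of_abs_lt_dvd hd (by rw [abs_lt]; constructor <;> omega)
      omega
    refine ⟨(φ q.1, j), hor.resolve_left fun h => hq.2 (mem_image.2 ⟨_, h, hιq⟩), hιq⟩
  have := card_sdiff_add_card_eq_card hDE
  rw [card_image_of_injective _ hιinj] at this
  omega

/-! ### Upper bound: rectangular cuts -/

open Finset in
/-- The `g`-extra connectivity is at most the size of the boundary `T \ A` of a connected set `A`,
provided that the complement of `T` is connected too and both are large enough. Connectedness is
witnessed by functions that decrease along suitable edges down to a single base point. -/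
theorem SimpleGraph.extraConnectivity_le_of_boundary {V : Type*} [Fintype V] [DecidableEq V]
    {G : SimpleGraph V} {g : ℕ} (A T : Finset V) (hAT : A ⊆ T)
    (hnbr : ∀ p ∈ A, ∀ q, G.Adj p q → q ∈ T)
    (hA : g + 1 ≤ #A) (hT : #T + (g + 1) ≤ Fintype.card V)
    (a b : V) (f f' : V → ℕ)
    (hf : ∀ p ∈ A, p = a ∨ ∃ q ∈ A, G.Adj p q ∧ f q < f p)
    (hf' : ∀ p, p ∉ T → p = b ∨ ∃ q, q ∉ T ∧ G.Adj p q ∧ f' q < f' p) :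
    G.extraConnectivity g ≤ ((#T - #A : ℕ) : ℕ∞) := by
  have hSc : ∀ p, p ∈ ((↑(T \ A) : Set V)ᶜ) ↔ p ∈ A ∨ p ∉ T := by
    intro p
    simp only [coe_sdiff, Set.mem_compl_iff, Set.mem_sdiff, mem_coe]
    have := @hAT p
    tauto
  have hreachA : ∀ k p (hp : p ∈ A), f p = k → ∃ ha : a ∈ A,
      (G.induce (↑(T \ A) : Set V)ᶜ).Reachable ⟨p, (hSc p).2 (Or.inl hp)⟩
        ⟨a, (hSc a).2 (Or.inl ha)⟩ := by
    intro k
    induction k using Nat.strong_induction_on with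
    | _ k ih =>
      intro p hp hk
      rcases hf p hp with rfl | ⟨q, hq, hpq, hlt⟩
      · exact ⟨hp, Reachable.refl _⟩
      · obtain ⟨ha, hr⟩ := ih (f q) (hk ▸ hlt) q hq rfl
        refine ⟨ha, Reachable.trans (Adj.reachable ?_) hr⟩
        exact hpq
  have hreachB : ∀ k p (hp : p ∉ T), f' p = k → ∃ hb : b ∉ T,
      (G.induce (↑(T \ A) : Set V)ᶜ).Reachable ⟨p, (hSc p).2 (Or.inr hp)⟩
        ⟨b, (hSc b).2 (Or.inr hb)⟩ := by
    intro k
    induction k using Nat.strong_induction_on with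
    | _ k ih =>
      intro p hp hk
      rcases hf' p hp with rfl | ⟨q, hq, hpq, hlt⟩
      · exact ⟨hp, Reachable.refl _⟩
      · obtain ⟨hb, hr⟩ := ih (f' q) (hk ▸ hlt) q hq rfl
        refine ⟨hb, Reachable.trans (Adj.reachable ?_) hr⟩
        exact hpq
  have hcut : G.IsExtraCut g (↑(T \ A) : Set V) := by
    constructor
    · intro hpre
      obtain ⟨p, hp⟩ := card_pos.1 (show 0 < #A by omega)
      obtain ⟨q, hq⟩ : ∃ q, q ∉ T := by
        by_contra! h
        have := card_univ (α := V)
        rw [← eq_univ_iff_forall.2 h] at this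
        omega
      have hr := hpre ⟨p, (hSc p).2 (Or.inl hp)⟩ ⟨q, (hSc q).2 (Or.inr hq)⟩
      rw [reachable_iff_reflTransGen] at hr
      -- A walk avoiding `T \ A` cannot leave `A`.
      have key : ∀ r, Relation.ReflTransGen (G.induce (↑(T \ A) : Set V)ᶜ).Adj
          ⟨p, (hSc p).2 (Or.inl hp)⟩ r → r.1 ∈ A := by
        intro r hr
        induction hr with
        | refl => exact hp
        | tail _ hbc ih =>
          exact ((hSc _).1 (Subtype.prop _)).resolve_right fun h => h (hnbr _ ih _ hbc)
      exact hq (hAT (key _ hr))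
    · intro c
      induction c using ConnectedComponent.ind with
      | _ p =>
      obtain ⟨p, hp⟩ := p
      rw [← Subtype.val_injective.encard_image]
      rcases (hSc p).1 hp with h | h
      · have hsub : (A : Set V) ⊆ Subtype.val ''
            ((G.induce (↑(T \ A) : Set V)ᶜ).connectedComponentMk ⟨p, hp⟩).supp := by
          intro q hq
          refine ⟨⟨q, (hSc q).2 (Or.inl hq)⟩, ConnectedComponent.sound ?_, rfl⟩
          obtain ⟨_, h1⟩ := hreachA _ q hq rfl
          obtain ⟨_, h2⟩ := hreachA _ p h rfl
          exact h1.trans h2.symm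
        refine le_trans ?_ (Set.encard_le_encard hsub)
        rw [Set.encard_coe_eq_coe_finsetCard]
        exact_mod_cast hA
      · have hsub : ((Tᶜ : Finset V) : Set V) ⊆ Subtype.val ''
            ((G.induce (↑(T \ A) : Set V)ᶜ).connectedComponentMk ⟨p, hp⟩).supp := by
          intro q hq
          rw [mem_coe, mem_compl] at hq
          refine ⟨⟨q, (hSc q).2 (Or.inr hq)⟩, ConnectedComponent.sound ?_, rfl⟩
          obtain ⟨_, h1⟩ := hreachB _ q hq rfl
          obtain ⟨_, h2⟩ := hreachB _ p h rfl
          exact h1.trans h2.symm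
        refine le_trans ?_ (Set.encard_le_encard hsub)
        rw [Set.encard_coe_eq_coe_finsetCard, card_compl]
        exact_mod_cast (by omega : g + 1 ≤ Fintype.card V - #T)
  refine (iInf₂_le _ hcut).trans ?_
  rw [Set.encard_coe_eq_coe_finsetCard, card_sdiff_of_subset hAT]

theorem SimpleGraph.cycleGraph_adj_of_val_add_one {m : ℕ} {u v : Fin m} (h : u.val + 1 = v.val) :
    (cycleGraph m).Adj u v :=
  pathGraph_le_cycleGraph (pathGraph_adj.2 (Or.inl h))

theorem SimpleGraph.val_of_cycleGraph_adj {m : ℕ} {u v : Fin m} (h : (cycleGraph m).Adj u v) :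
    u.val + 1 = v.val ∨ v.val + 1 = u.val ∨ (u.val = 0 ∧ v.val + 1 = m) ∨
      (v.val = 0 ∧ u.val + 1 = m) := by
  have key : ∀ a b : Fin m, (a - b).val = 1 → b.val + 1 = a.val ∨ (a.val = 0 ∧ b.val + 1 = m) := by
    intro a b hab
    have ha := a.isLt
    have hb := b.isLt
    rcases le_or_gt b a with hle | hlt
    · rw [Fin.coe_sub_iff_le.2 hle] at hab
      omega
    · rw [Fin.coe_sub_iff_lt.2 hlt] at hab
      omega
  rcases cycleGraph_adj'.1 h with h | h
  · rcases key _ _ h with h | h <;> omega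
  · rcases key _ _ h with h | h <;> omega

theorem Fin.card_filter_le_val_lt {m l r : ℕ} (h : r ≤ m) :
    (Finset.univ.filter fun i : Fin m => l ≤ i.val ∧ i.val < r).card = r - l := by
  rw [← Nat.card_Ico, ← Finset.card_map Fin.valEmbedding]
  congr 1
  ext i
  simp only [Finset.mem_map, Finset.mem_filter, Finset.mem_univ, true_and, Finset.mem_Ico,
    Fin.valEmbedding_apply]
  exact ⟨fun ⟨j, hj, e⟩ => e ▸ hj, fun hi => ⟨⟨i, by omega⟩, hi, rfl⟩⟩

open Finset in
/-- The rectangle of `C_m ⊠ P_n` with columns in `[l, r)` and rows in `[0, t)`. -/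
def Fin.rectangle (m n l r t : ℕ) : Finset (Fin m × Fin n) :=
  (univ.filter fun i : Fin m => l ≤ i.val ∧ i.val < r) ×ˢ
    (univ.filter fun j : Fin n => 0 ≤ j.val ∧ j.val < t)

theorem Fin.mem_rectangle {m n l r t : ℕ} {p : Fin m × Fin n} :
    p ∈ Fin.rectangle m n l r t ↔ (l ≤ p.1.val ∧ p.1.val < r) ∧ p.2.val < t := by
  simp [Fin.rectangle]

theorem Fin.card_rectangle {m n l r t : ℕ} (hr : r ≤ m) (ht : t ≤ n) :
    (Fin.rectangle m n l r t).card = (r - l) * t := by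
  rw [Fin.rectangle, Finset.card_product, Fin.card_filter_le_val_lt hr,
    Fin.card_filter_le_val_lt ht, Nat.sub_zero]

/-- A vertex of a rectangle can be moved towards the corner `(l, 0)`. -/
theorem SimpleGraph.rectangle_step {m n l r t : ℕ} (hl : l < m) (hn : 0 < n) :
    ∀ p ∈ Fin.rectangle m n l r t, p = (⟨l, hl⟩, ⟨0, hn⟩) ∨
      ∃ q ∈ Fin.rectangle m n l r t,
        ((cycleGraph m).strongProd (pathGraph n)).Adj p q ∧
          q.1.val + q.2.val < p.1.val + p.2.val := by
  rintro ⟨⟨i, hi⟩, ⟨j, hj⟩⟩ hp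
  simp only [Fin.mem_rectangle] at hp
  by_cases h1 : i = l
  · by_cases h2 : j = 0
    · left; subst h1 h2; rfl
    · right
      refine ⟨(⟨i, hi⟩, ⟨j - 1, by omega⟩), Fin.mem_rectangle.2 (by dsimp only; omega),
        Or.inl ⟨rfl, pathGraph_adj.2 (by dsimp only; omega)⟩, by dsimp only; omega⟩
  · right
    refine ⟨(⟨i - 1, by omega⟩, ⟨j, hj⟩), Fin.mem_rectangle.2 (by dsimp only; omega),
      Or.inr (Or.inl ⟨rfl, (cycleGraph_adj_of_val_add_one (by dsimp only; omega)).symm⟩),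
      by dsimp only; omega⟩

/-- A vertex outside a rectangle that starts at column `0` can be moved towards the corner
`(m - 1, n - 1)` without entering the rectangle. -/
theorem SimpleGraph.compl_rectangle_step {m n r t : ℕ} (hm : 0 < m) (hn : 0 < n) :
    ∀ p, p ∉ Fin.rectangle m n 0 r t → p = (⟨m - 1, by omega⟩, ⟨n - 1, by omega⟩) ∨
      ∃ q, q ∉ Fin.rectangle m n 0 r t ∧
        ((cycleGraph m).strongProd (pathGraph n)).Adj p q ∧
          (m - q.1.val) + (n - q.2.val) < (m - p.1.val) + (n - p.2.val) := by
  rintro ⟨⟨i, hi⟩, ⟨j, hj⟩⟩ hp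
  simp only [Fin.mem_rectangle] at hp
  by_cases h1 : i = m - 1
  · by_cases h2 : j = n - 1
    · left; subst h1 h2; rfl
    · right
      refine ⟨(⟨i, hi⟩, ⟨j + 1, by omega⟩), fun h => ?_,
        Or.inl ⟨rfl, pathGraph_adj.2 (by dsimp only; omega)⟩, by dsimp only; omega⟩
      simp only [Fin.mem_rectangle] at h
      omega
  · right
    refine ⟨(⟨i + 1, by omega⟩, ⟨j, hj⟩), fun h => ?_,
      Or.inr (Or.inl ⟨rfl, cycleGraph_adj_of_val_add_one (by dsimp only)⟩),
      by dsimp only; omega⟩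
    simp only [Fin.mem_rectangle] at h
    omega

/-- The rectangle with columns in `[l, r)` and rows in `[0, t)` is cut off by the rest of the
rectangle with columns in `[0, r')` and rows in `[0, t')`, if this contains its neighbours. -/
theorem SimpleGraph.extraConnectivity_le_of_rectangle {m n g l r t r' t' : ℕ} (hn : 0 < n)
    (hcol : (l = 0 ∧ r = m ∧ r' = m) ∨ (l = 1 ∧ r + 1 = r' ∧ r' < m))
    (hrow : (t = n ∧ t' = n) ∨ (t + 1 = t' ∧ t' ≤ n))
    (hA : g + 1 ≤ (r - l) * t) (hT : r' * t' + (g + 1) ≤ m * n) :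
    ((cycleGraph m).strongProd (pathGraph n)).extraConnectivity g ≤
      ((r' * t' - (r - l) * t : ℕ) : ℕ∞) := by
  have hrl : 0 < r - l := Nat.pos_of_ne_zero fun h => by simp [h] at hA
  have hcA : (Fin.rectangle m n l r t).card = (r - l) * t :=
    Fin.card_rectangle (by omega) (by omega)
  have hcT : (Fin.rectangle m n 0 r' t').card = r' * t' := by
    rw [Fin.card_rectangle (by omega) (by omega), Nat.sub_zero]
  rw [← hcA, ← hcT]
  refine extraConnectivity_le_of_boundary _ _ ?_ ?_ (by rwa [hcA]) ?_ _ _ _ _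
    (rectangle_step (by omega) hn) (compl_rectangle_step (by omega) hn)
  · intro p hp
    rw [Fin.mem_rectangle] at hp ⊢
    omega
  · intro p hp q hpq
    rw [Fin.mem_rectangle] at hp ⊢
    have hq1 := q.1.isLt
    have hq2 := q.2.isLt
    rcases hpq with ⟨h1, h2⟩ | ⟨h2, h1⟩ | ⟨h1, h2⟩
    · rw [pathGraph_adj] at h2
      rw [← h1]
      omega
    · have := val_of_cycleGraph_adj h1
      rw [← h2]
      omega
    · have := val_of_cycleGraph_adj h1
      rw [pathGraph_adj] at h2
      omega
  · rw [hcT, Fintype.card_prod, Fintype.card_fin, Fintype.card_fin]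
    exact hT

/-! ### Arithmetic and conclusion -/

/-- If `8 * N ≤ s ^ 2` then `N` unit squares fit into an `a × b` rectangle with `a + 2 * b = s`. -/
theorem Nat.exists_add_two_mul_eq {N s : ℕ} (hN : 0 < N) (h : 8 * N ≤ s ^ 2) :
    ∃ a b : ℕ, 0 < a ∧ 0 < b ∧ a + 2 * b = s ∧ N ≤ a * b := by
  have hs : 3 ≤ s := by
    by_contra! hlt
    interval_cases s <;> omega
  -- The product is largest near `a = 2 * b`; with `b = k + 1` it equals `⌊s² / 8⌋` for every
  -- residue. Starting at `3` keeps `a` positive.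
  obtain ⟨k, hk⟩ : ∃ k, s = 4 * k + 3 ∨ s = 4 * k + 4 ∨ s = 4 * k + 5 ∨ s = 4 * k + 6 :=
    ⟨(s - 3) / 4, by omega⟩
  rcases hk with rfl | rfl | rfl | rfl
  · exact ⟨2 * k + 1, k + 1, by omega, by omega, by ring, by ring_nf at h ⊢; omega⟩
  · exact ⟨2 * k + 2, k + 1, by omega, by omega, by ring, by ring_nf at h ⊢; omega⟩
  · exact ⟨2 * k + 3, k + 1, by omega, by omega, by ring, by ring_nf at h ⊢; omega⟩
  · exact ⟨2 * k + 4, k + 1, by omega, by omega, by ring, by ring_nf at h ⊢; omega⟩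

/-- Squaring removes the real square root from both bounds. -/
theorem Nat.ceil_two_mul_sqrt_le_iff {N s : ℕ} :
    ⌈2 * Real.sqrt (2 * (N : ℝ))⌉₊ ≤ s ↔ 8 * N ≤ s ^ 2 := by
  rw [Nat.ceil_le, ← Nat.cast_le (α := ℝ)]
  have h0 := Real.sqrt_nonneg (2 * (N : ℝ))
  have h1 : (2 * Real.sqrt (2 * (N : ℝ))) ^ 2 = 8 * N := by
    rw [mul_pow, Real.sq_sqrt (by positivity)]; ring
  rw [← pow_le_pow_iff_left₀ (by positivity) (by positivity) two_ne_zero, h1]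
  push_cast
  rfl

theorem theorem3p2 (m n g : ℕ) (hm : 4 ≤ m) (hn : 3 ≤ n)
    (hg : g ≤ min (n * ((m - 2) / 2) - 1) (m * ((n - 1) / 2) - 1)) :
    ((SimpleGraph.cycleGraph m).strongProd (SimpleGraph.pathGraph n)).extraConnectivity g =
      ((min m (min (2 * n) (⌈2 * Real.sqrt (2 * ((g : ℝ) + 1))⌉₊ + 2)) : ℕ) : ℕ∞) := by
  rw [show (g : ℝ) + 1 = ((g + 1 : ℕ) : ℝ) by push_cast; ring]
  obtain ⟨hg1, hg2⟩ := le_min_iff.1 hg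
  apply le_antisymm
  · have hub_m : ((SimpleGraph.cycleGraph m).strongProd
        (SimpleGraph.pathGraph n)).extraConnectivity g ≤ (m : ℕ∞) := by
      -- Positivity makes the truncated `- 1` in `hg2` genuine, giving `g + 1 ≤ m * k`.
      have hpos : 0 < m * ((n - 1) / 2) := Nat.mul_pos (by omega) (by omega)
      obtain ⟨k, hk⟩ : ∃ k, k = (n - 1) / 2 := ⟨_, rfl⟩
      rw [← hk] at hg2 hpos
      have h2k : m * (2 * k + 1) ≤ m * n := Nat.mul_le_mul_left _ (by omega)
      refine (SimpleGraph.extraConnectivity_le_of_rectangle (l := 0) (r := m) (t := k) (r' := m)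
        (t' := k + 1) (by omega) (Or.inl ⟨rfl, rfl, rfl⟩) (Or.inr ⟨rfl, by omega⟩)
        (by rw [Nat.sub_zero]; omega) (by linarith [show g + 1 ≤ m * k by omega])).trans ?_
      rw [Nat.sub_zero, Nat.mul_succ, Nat.add_sub_cancel_left]
    have hub_n : ((SimpleGraph.cycleGraph m).strongProd
        (SimpleGraph.pathGraph n)).extraConnectivity g ≤ ((2 * n : ℕ) : ℕ∞) := by
      have hpos : 0 < n * ((m - 2) / 2) := Nat.mul_pos (by omega) (by omega)
      obtain ⟨k, hk⟩ : ∃ k, k = (m - 2) / 2 := ⟨_, rfl⟩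
      rw [← hk] at hg1 hpos
      have h2k : (2 * k + 2) * n ≤ m * n := Nat.mul_le_mul_right _ (by omega)
      refine (SimpleGraph.extraConnectivity_le_of_rectangle (l := 1) (r := k + 1) (t := n)
        (r' := k + 2) (t' := n) (by omega) (Or.inr ⟨rfl, rfl, by omega⟩) (Or.inl ⟨rfl, rfl⟩)
        (by rw [Nat.add_sub_cancel, mul_comm]; omega)
        (by linarith [show g + 1 ≤ n * k by omega])).trans ?_
      rw [Nat.add_sub_cancel, Nat.add_mul, Nat.add_sub_cancel_left]
    set s := ⌈2 * Real.sqrt (2 * ((g + 1 : ℕ) : ℝ))⌉₊ with hs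
    by_cases h1 : m ≤ s + 2
    · rw [Nat.mono_cast.map_min, Nat.mono_cast.map_min]
      refine le_min hub_m (le_min hub_n (hub_m.trans (by exact_mod_cast h1)))
    by_cases h2 : 2 * n ≤ s + 2
    · rw [Nat.mono_cast.map_min, Nat.mono_cast.map_min]
      refine le_min hub_m (le_min hub_n (hub_n.trans (by exact_mod_cast h2)))
    rw [Nat.mono_cast.map_min, Nat.mono_cast.map_min]
    refine le_min hub_m (le_min hub_n ?_)
    obtain ⟨a, b, ha, hb, hab, hN⟩ := Nat.exists_add_two_mul_eq (Nat.succ_pos g)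
      (Nat.ceil_two_mul_sqrt_le_iff.1 hs.ge)
    -- The complement is large enough because `a + 2 * b + 2` is below both `m` and `2 * n`, so its
    -- square is at most `2 * m * n`.
    have hT : (a + 2) * (b + 1) + (g + 1) ≤ m * n := by
      have h3 : (a + 2 * b + 2) * (2 * b + a + 2) ≤ m * (2 * n) :=
        Nat.mul_le_mul (by omega) (by omega)
      nlinarith [Nat.zero_le (a * b), Nat.zero_le (a * a), Nat.zero_le (b * b)]
    refine (SimpleGraph.extraConnectivity_le_of_rectangle (l := 1) (r := a + 1) (t := b)
      (r' := a + 2) (t' := b + 1) (by omega) (Or.inr ⟨rfl, rfl, by omega⟩)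
      (Or.inr ⟨rfl, by omega⟩) (by rwa [Nat.add_sub_cancel]) hT).trans ?_
    rw [Nat.add_sub_cancel, ← hab]
    have : (a + 2) * (b + 1) - a * b = a + 2 * b + 2 := by
      rw [show (a + 2) * (b + 1) = a * b + (a + 2 * b + 2) by ring, Nat.add_sub_cancel_left]
    rw [this]
  · refine le_iInf₂ fun S hS => ?_
    obtain ⟨S, rfl⟩ := S.toFinite.exists_finset_coe
    rw [Set.encard_coe_eq_coe_finsetCard, Nat.cast_le]
    by_contra! hlt
    obtain ⟨h1, h2, h3⟩ : S.card < m ∧ S.card < 2 * n ∧ _ := by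
      simpa only [lt_min_iff] using hlt
    obtain ⟨a, b, hab, hle⟩ := hS.exists_le_card (by omega) h1 h2
    -- AM-GM for `a` and `2 * b`.
    have hsq : 8 * (g + 1) ≤ (a + 2 * b) ^ 2 := by
      zify at hab ⊢
      nlinarith [sq_nonneg ((a : ℤ) - 2 * b)]
    have := Nat.ceil_two_mul_sqrt_le_iff.2 hsq
    omega
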